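/- Let $K$ be a field of characteristic zero, let $n \ge 1$ be an integer, and let $a,b,c \ge 0$ be integers with $a+b+c=n$. Let $e_1,\dots,e_n$ be the standard basis of $K^n$, and let $\mathfrak p(a,b,c \mid n)$ be the Lie algebra of all trace-zero matrices in $\mathfrak{sl}(n,K)$ that preserve the subspaces $\operatorname{span}\{e_1,\dots,e_a\}$ and $\operatorname{span}\{e_1,\dots,e_{a+b}\}$; that is, the seaweed algebra of the compositions $(a,b,c)$ and $(n)$ of $n$, whose second flag is trivial. The index of a finite-dimensional Lie algebra $\mathfrak L$ over $K$ is $$\operatorname{ind}\mathfrak L=\min_{F\in\mathfrak L^*}\dim\ker B_F,\qquad B_F(x,y)=F([x,y]),$$ and $\mathfrak L$ is called Frobenius if $\operatorname{ind}\mathfrak L=0$. Then $\mathfrak p(a,b,c\mid n)$ is Frobenius if and only if $\gcd(a+b,b+c)=1$. -/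

import Mathlib

namespace Seaweed

attribute [local instance 100] LieRing.ofAssociativeRing

section Index

variable (K L : Type*) [Field K] [LieRing L] [LieAlgebra K L]

/-- The skew form `B_F (x, y) = F ⁅x, y⁆` attached to a functional `F` on `L`. -/
def kirillovForm (F : Module.Dual K L) : LinearMap.BilinForm K L :=
  LinearMap.mk₂ K (fun x y : L => F ⁅x, y⁆)
    (fun x₁ x₂ y => by rw [add_lie, map_add])
    (fun r x y => by rw [smul_lie, map_smul])
    (fun x y₁ y₂ => by rw [lie_add, map_add])
    (fun r x y => by rw [lie_smul, map_smul])

/-- The index of a finite-dimensional Lie algebra: the minimum over all functionals `F`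
of the dimension of the kernel of `B_F`. -/
noncomputable def index [Module.Finite K L] : ℕ :=
  ⨅ F : Module.Dual K L, Module.finrank K (LinearMap.ker (kirillovForm K L F))

/-- A Lie algebra is Frobenius if its index is zero. -/
def IsFrobenius [Module.Finite K L] : Prop :=
  index K L = 0

end Index

section Algebra

variable (K : Type*) [Field K] (n : ℕ)

/-- `V_i = span {e_1, …, e_{a_1 + ⋯ + a_i}}` for `x = (a_1, …, a_m)`; the basis vectors are
indexed from `0` in `Fin n`. -/
def upperFlag (x : List ℕ) (i : ℕ) : Submodule K (Fin n → K) :=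
  Submodule.span K ((fun k : Fin n => Pi.single k (1 : K)) '' {k | (k : ℕ) < (x.take i).sum})

/-- `W_j = span {e_{b_1 + ⋯ + b_j + 1}, …, e_n}` for `y = (b_1, …, b_t)`; the basis vectors are
indexed from `0` in `Fin n`. -/
def lowerFlag (y : List ℕ) (j : ℕ) : Submodule K (Fin n → K) :=
  Submodule.span K ((fun k : Fin n => Pi.single k (1 : K)) '' {k | (y.take j).sum ≤ (k : ℕ)})

variable {K n} in
/-- The Lie algebra of all matrices that map the subspace `U` into itself. -/
def stabilizer (U : Submodule K (Fin n → K)) :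
    LieSubalgebra K (Matrix (Fin n) (Fin n) K) where
  carrier := {A | ∀ v ∈ U, A.mulVec v ∈ U}
  zero_mem' := fun v _ => by rw [Matrix.zero_mulVec]; exact U.zero_mem
  add_mem' := fun {A B} hA hB v hv => by
    rw [Matrix.add_mulVec]; exact U.add_mem (hA v hv) (hB v hv)
  smul_mem' := fun r A hA v hv => by
    rw [Matrix.smul_mulVec]; exact U.smul_mem r (hA v hv)
  lie_mem' := fun {A B} hA hB v hv => by
    rw [Ring.lie_def, Matrix.sub_mulVec, ← Matrix.mulVec_mulVec, ← Matrix.mulVec_mulVec]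
    exact U.sub_mem (hA _ (hB v hv)) (hB _ (hA v hv))

/-- The seaweed algebra `𝔭(x | y)`: the subalgebra of `𝔰𝔩(n)` that preserves both flags. It is
meant for lists `x` and `y` with sum `n`. -/
def seaweed (x y : List ℕ) : LieSubalgebra K (Matrix (Fin n) (Fin n) K) :=
  LieAlgebra.SpecialLinear.sl (Fin n) K ⊓
    (⨅ i : ℕ, stabilizer (upperFlag K n x i)) ⊓ (⨅ j : ℕ, stabilizer (lowerFlag K n y j))

instance seaweed_finite (x y : List ℕ) : Module.Finite K (seaweed K n x y) :=
  inferInstanceAs (Module.Finite K (seaweed K n x y).toSubmodule)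

end Algebra

end Seaweed

/-! The trace form represents a functional on block upper triangular matrices by a matrix `f`, of
which only the block lower triangular part matters, and tr(f[x,y]) = tr([f,x]y). In characteristic
zero the scalars split off from trace-zero matrices. So the algebra is Frobenius exactly when some
`f` is rigid: only scalar block upper triangular `x` make [f,x] strictly block upper triangular
(`isFrobenius_seaweed_iff`).

Rigidity runs a Euclidean algorithm on the block sizes. The corner `f31 : A → C` of a rigid `f` must
have maximal rank. If it is injective, it becomes the inclusion into C = A × D. The stabilizer
equations then express several blocks of `x` through the others, and the rest are the stabilizer
equations of a smaller algebra, the endomorphisms of B × D × A that preserve B and A (a "wedge").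
The two families are closed under such reductions: chain (a, b, a+d) ↔ wedge (b, d, a), wedge (a,
a+d, c) ↔ chain (c, a, d), wedge (b+a, b, c) ↔ wedge (a, b, c). A chain with a ≥ c is transposed.
These moves preserve gcd(a+b, b+c) for chains and gcd(a+c, b) for wedges, passing from one to the
other, and end in the trivial cases wedge (a, 0, c) and chain (0, 0, c); see `frobenius_iff_gcd`. -/

namespace Seaweed

open Module

/-! ### Functionals, stabilizers and rigidity in block form -/

section Blocks

variable (K : Type*) [Field K]
variable (A B C : Type*) [AddCommGroup A] [Module K A] [AddCommGroup B] [Module K B]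
  [AddCommGroup C] [Module K C]

/-- The block lower triangular part of an endomorphism of `A × B × C`, which is a functional on
the algebra of block upper triangular endomorphisms by means of the trace form. -/
structure ChainFunctional where
  f11 : A →ₗ[K] A
  f21 : A →ₗ[K] B
  f22 : B →ₗ[K] B
  f31 : A →ₗ[K] C
  f32 : B →ₗ[K] C
  f33 : C →ₗ[K] C

/-- A block upper triangular endomorphism of `A × B × C`. -/
structure ChainElement where
  x11 : A →ₗ[K] A
  x12 : B →ₗ[K] A
  x13 : C →ₗ[K] A
  x22 : B →ₗ[K] B
  x23 : C →ₗ[K] B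
  x33 : C →ₗ[K] C

/-- A functional, by means of the trace form, on the algebra of endomorphisms of `A × B × C`
that preserve `A` and `C`. -/
structure WedgeFunctional where
  f11 : A →ₗ[K] A
  f21 : A →ₗ[K] B
  f22 : B →ₗ[K] B
  f23 : C →ₗ[K] B
  f33 : C →ₗ[K] C

/-- An endomorphism of `A × B × C` that preserves `A` and `C`. -/
structure WedgeElement where
  x11 : A →ₗ[K] A
  x12 : B →ₗ[K] A
  x22 : B →ₗ[K] B
  x32 : B →ₗ[K] C
  x33 : C →ₗ[K] C

variable {K A B C}

/-- The commutator of `f` and `x` is orthogonal to all block upper triangular endomorphisms. -/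
structure ChainFunctional.Stabilizes (f : ChainFunctional K A B C) (x : ChainElement K A B C) :
    Prop where
  h31 : ∀ v, f.f31 (x.x11 v) = x.x33 (f.f31 v)
  h21 : ∀ v, f.f21 (x.x11 v) = x.x22 (f.f21 v) + x.x23 (f.f31 v)
  h11 : ∀ v, f.f11 (x.x11 v) = x.x11 (f.f11 v) + x.x12 (f.f21 v) + x.x13 (f.f31 v)
  h22 : ∀ v, f.f21 (x.x12 v) + f.f22 (x.x22 v) = x.x22 (f.f22 v) + x.x23 (f.f32 v)
  h32 : ∀ v, f.f31 (x.x12 v) + f.f32 (x.x22 v) = x.x33 (f.f32 v)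
  h33 : ∀ v, f.f31 (x.x13 v) + f.f32 (x.x23 v) + f.f33 (x.x33 v) = x.x33 (f.f33 v)

/-- The block upper triangular endomorphism `x` is multiplication by `t`. -/
structure ChainElement.IsScalar (x : ChainElement K A B C) (t : K) : Prop where
  h11 : ∀ v, x.x11 v = t • v
  h12 : ∀ v, x.x12 v = 0
  h13 : ∀ v, x.x13 v = 0
  h22 : ∀ v, x.x22 v = t • v
  h23 : ∀ v, x.x23 v = 0
  h33 : ∀ v, x.x33 v = t • v

/-- The stabilizer of `f` consists of scalars only. -/
def ChainFunctional.Rigid (f : ChainFunctional K A B C) : Prop :=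
  ∀ x, f.Stabilizes x → ∃ t, x.IsScalar t

/-- The commutator of `f` and `x` is orthogonal to all endomorphisms that preserve `A` and `C`. -/
structure WedgeFunctional.Stabilizes (f : WedgeFunctional K A B C) (x : WedgeElement K A B C) :
    Prop where
  h21 : ∀ v, f.f21 (x.x11 v) = x.x22 (f.f21 v)
  h11 : ∀ v, f.f11 (x.x11 v) = x.x11 (f.f11 v) + x.x12 (f.f21 v)
  h22 : ∀ v, f.f21 (x.x12 v) + f.f22 (x.x22 v) + f.f23 (x.x32 v) = x.x22 (f.f22 v)
  h23 : ∀ v, f.f23 (x.x33 v) = x.x22 (f.f23 v)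
  h33 : ∀ v, f.f33 (x.x33 v) = x.x33 (f.f33 v) + x.x32 (f.f23 v)

/-- The endomorphism `x` is multiplication by `t`. -/
structure WedgeElement.IsScalar (x : WedgeElement K A B C) (t : K) : Prop where
  h11 : ∀ v, x.x11 v = t • v
  h12 : ∀ v, x.x12 v = 0
  h22 : ∀ v, x.x22 v = t • v
  h32 : ∀ v, x.x32 v = 0
  h33 : ∀ v, x.x33 v = t • v

/-- The stabilizer of `f` consists of scalars only. -/
def WedgeFunctional.Rigid (f : WedgeFunctional K A B C) : Prop :=
  ∀ x, f.Stabilizes x → ∃ t, x.IsScalar t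

end Blocks

/-! ### Invariance of rigidity under change of basis in each block -/

section Congr

variable {K : Type*} [Field K]
variable {A B C A' B' C' : Type*} [AddCommGroup A] [Module K A] [AddCommGroup B] [Module K B]
  [AddCommGroup C] [Module K C] [AddCommGroup A'] [Module K A'] [AddCommGroup B'] [Module K B']
  [AddCommGroup C'] [Module K C']

/-- Transport of a functional along isomorphisms of the blocks. -/
def ChainFunctional.congr (f : ChainFunctional K A B C) (e₁ : A ≃ₗ[K] A') (e₂ : B ≃ₗ[K] B')
    (e₃ : C ≃ₗ[K] C') : ChainFunctional K A' B' C' where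
  f11 := e₁ ∘ₗ f.f11 ∘ₗ e₁.symm
  f21 := e₂ ∘ₗ f.f21 ∘ₗ e₁.symm
  f22 := e₂ ∘ₗ f.f22 ∘ₗ e₂.symm
  f31 := e₃ ∘ₗ f.f31 ∘ₗ e₁.symm
  f32 := e₃ ∘ₗ f.f32 ∘ₗ e₂.symm
  f33 := e₃ ∘ₗ f.f33 ∘ₗ e₃.symm

theorem ChainFunctional.Rigid.congr {f : ChainFunctional K A B C} (hf : f.Rigid)
    (e₁ : A ≃ₗ[K] A') (e₂ : B ≃ₗ[K] B') (e₃ : C ≃ₗ[K] C') : (f.congr e₁ e₂ e₃).Rigid := by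
  intro x hx
  obtain ⟨t, ht⟩ := hf
    { x11 := e₁.symm ∘ₗ x.x11 ∘ₗ e₁
      x12 := e₁.symm ∘ₗ x.x12 ∘ₗ e₂
      x13 := e₁.symm ∘ₗ x.x13 ∘ₗ e₃
      x22 := e₂.symm ∘ₗ x.x22 ∘ₗ e₂
      x23 := e₂.symm ∘ₗ x.x23 ∘ₗ e₃
      x33 := e₃.symm ∘ₗ x.x33 ∘ₗ e₃ }
    { h31 := fun v => by simpa [ChainFunctional.congr, LinearEquiv.eq_symm_apply] using hx.h31 (e₁ v)
      h21 := fun v => by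
        simpa [ChainFunctional.congr, ← map_add, LinearEquiv.eq_symm_apply] using hx.h21 (e₁ v)
      h11 := fun v => by
        simpa [ChainFunctional.congr, ← map_add, LinearEquiv.eq_symm_apply] using hx.h11 (e₁ v)
      h22 := fun v => by
        simpa [ChainFunctional.congr, ← map_add, LinearEquiv.eq_symm_apply] using hx.h22 (e₂ v)
      h32 := fun v => by
        simpa [ChainFunctional.congr, ← map_add, LinearEquiv.eq_symm_apply] using hx.h32 (e₂ v)
      h33 := fun v => by
        simpa [ChainFunctional.congr, ← map_add, LinearEquiv.eq_symm_apply] using hx.h33 (e₃ v) }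
  exact ⟨t,
    { h11 := fun v => by simpa [LinearEquiv.symm_apply_eq] using ht.h11 (e₁.symm v)
      h12 := fun v => by simpa [LinearEquiv.symm_apply_eq] using ht.h12 (e₂.symm v)
      h13 := fun v => by simpa [LinearEquiv.symm_apply_eq] using ht.h13 (e₃.symm v)
      h22 := fun v => by simpa [LinearEquiv.symm_apply_eq] using ht.h22 (e₂.symm v)
      h23 := fun v => by simpa [LinearEquiv.symm_apply_eq] using ht.h23 (e₃.symm v)
      h33 := fun v => by simpa [LinearEquiv.symm_apply_eq] using ht.h33 (e₃.symm v) }⟩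

/-- Transport of a functional along isomorphisms of the blocks. -/
def WedgeFunctional.congr (f : WedgeFunctional K A B C) (e₁ : A ≃ₗ[K] A') (e₂ : B ≃ₗ[K] B')
    (e₃ : C ≃ₗ[K] C') : WedgeFunctional K A' B' C' where
  f11 := e₁ ∘ₗ f.f11 ∘ₗ e₁.symm
  f21 := e₂ ∘ₗ f.f21 ∘ₗ e₁.symm
  f22 := e₂ ∘ₗ f.f22 ∘ₗ e₂.symm
  f23 := e₂ ∘ₗ f.f23 ∘ₗ e₃.symm
  f33 := e₃ ∘ₗ f.f33 ∘ₗ e₃.symm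

theorem WedgeFunctional.Rigid.congr {f : WedgeFunctional K A B C} (hf : f.Rigid)
    (e₁ : A ≃ₗ[K] A') (e₂ : B ≃ₗ[K] B') (e₃ : C ≃ₗ[K] C') : (f.congr e₁ e₂ e₃).Rigid := by
  intro x hx
  obtain ⟨t, ht⟩ := hf
    { x11 := e₁.symm ∘ₗ x.x11 ∘ₗ e₁
      x12 := e₁.symm ∘ₗ x.x12 ∘ₗ e₂
      x22 := e₂.symm ∘ₗ x.x22 ∘ₗ e₂
      x32 := e₃.symm ∘ₗ x.x32 ∘ₗ e₂
      x33 := e₃.symm ∘ₗ x.x33 ∘ₗ e₃ }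
    { h21 := fun v => by simpa [WedgeFunctional.congr, LinearEquiv.eq_symm_apply] using hx.h21 (e₁ v)
      h11 := fun v => by
        simpa [WedgeFunctional.congr, ← map_add, LinearEquiv.eq_symm_apply] using hx.h11 (e₁ v)
      h22 := fun v => by
        simpa [WedgeFunctional.congr, ← map_add, LinearEquiv.eq_symm_apply] using hx.h22 (e₂ v)
      h23 := fun v => by simpa [WedgeFunctional.congr, LinearEquiv.eq_symm_apply] using hx.h23 (e₃ v)
      h33 := fun v => by
        simpa [WedgeFunctional.congr, ← map_add, LinearEquiv.eq_symm_apply] using hx.h33 (e₃ v) }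
  exact ⟨t,
    { h11 := fun v => by simpa [LinearEquiv.symm_apply_eq] using ht.h11 (e₁.symm v)
      h12 := fun v => by simpa [LinearEquiv.symm_apply_eq] using ht.h12 (e₂.symm v)
      h22 := fun v => by simpa [LinearEquiv.symm_apply_eq] using ht.h22 (e₂.symm v)
      h32 := fun v => by simpa [LinearEquiv.symm_apply_eq] using ht.h32 (e₂.symm v)
      h33 := fun v => by simpa [LinearEquiv.symm_apply_eq] using ht.h33 (e₃.symm v) }⟩

end Congr

/-! ### Linear algebra: splittings and two-sided annihilators -/

section Splitting

variable {K : Type*} [Field K]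
variable {A B C : Type*} [AddCommGroup A] [Module K A] [AddCommGroup B] [Module K B]
  [AddCommGroup C] [Module K C]

theorem exists_eq_coprod (f : A × B →ₗ[K] C) : ∃ g h, f = LinearMap.coprod g h :=
  ⟨f ∘ₗ LinearMap.inl K A B, f ∘ₗ LinearMap.inr K A B, by ext <;> simp⟩

theorem exists_eq_prod (f : C →ₗ[K] A × B) : ∃ g h, f = LinearMap.prod g h :=
  ⟨LinearMap.fst K A B ∘ₗ f, LinearMap.snd K A B ∘ₗ f, by ext <;> simp⟩

/-- A split injection is, up to an isomorphism, the inclusion of a factor. -/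
theorem exists_equiv_prod [FiniteDimensional K A] [FiniteDimensional K B] [FiniteDimensional K C]
    {i : A →ₗ[K] C} {r : C →ₗ[K] A} (h : r ∘ₗ i = LinearMap.id)
    (hd : finrank K C = finrank K A + finrank K B) :
    ∃ e : C ≃ₗ[K] A × B, e ∘ₗ i = LinearMap.inl K A B ∧ LinearMap.fst K A B ∘ₗ e = r := by
  have hri (a : A) : r (i a) = a := LinearMap.congr_fun h a
  let e₀ : C ≃ₗ[K] A × LinearMap.ker r :=
    LinearEquiv.ofLinearMap
      (r.prod ((LinearMap.id - i ∘ₗ r).codRestrict _ fun c => by simp [hri]))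
      (i.coprod (LinearMap.ker r).subtype)
      (by ext x <;> simp [hri]) (by ext; simp)
  have hk : finrank K (LinearMap.ker r) = finrank K B := by
    have := e₀.finrank_eq
    rw [finrank_prod] at this
    omega
  refine ⟨e₀ ≪≫ₗ (LinearEquiv.refl K A).prodCongr (LinearEquiv.ofFinrankEq _ _ hk), ?_, ?_⟩
  · ext a
    · simp [e₀, hri]
    · have : e₀ (i a) = (a, 0) := by ext <;> simp [e₀, hri]
      simp [this]
  · ext; simp [e₀]

/-- A map that is neither injective nor surjective is annihilated on both sides by a nonzero
map. -/
theorem exists_two_sided_annihilator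
    {f : A →ₗ[K] C} (hf : ¬ Function.Injective f) (hs : ¬ Function.Surjective f) :
    ∃ y : C →ₗ[K] A, (∀ v, f (y v) = 0) ∧ (∀ v, y (f v) = 0) ∧ ∃ v, y v ≠ 0 := by
  obtain ⟨a, ha, ha0⟩ : ∃ a, f a = 0 ∧ a ≠ 0 := by
    simpa [injective_iff_map_eq_zero] using hf
  have hlt : LinearMap.range f < ⊤ := lt_top_iff_ne_top.2 (mt LinearMap.range_eq_top.1 hs)
  obtain ⟨φ, hφ, hle⟩ := Submodule.exists_le_ker_of_lt_top _ hlt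
  refine ⟨φ.smulRight a, by simp [ha], fun v => ?_, ?_⟩
  · have : φ (f v) = 0 := hle ⟨v, rfl⟩
    simp [this]
  · by_contra! h
    exact hφ (LinearMap.ext fun v => by simpa [ha0] using h v)

end Splitting

/-! ### The reduction moves and transposition -/

section Reduction

variable {K : Type*} [Field K]
variable {A B C D : Type*} [AddCommGroup A] [Module K A] [AddCommGroup B] [Module K B]
  [AddCommGroup C] [Module K C] [AddCommGroup D] [Module K D]

/-- Adjoining to a wedge functional a first block that the functional embeds into the last one. -/
def WedgeFunctional.toChain (g : WedgeFunctional K B D A) : ChainFunctional K A B (A × D) where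
  f11 := 0
  f21 := 0
  f22 := g.f11
  f31 := LinearMap.inl K A D
  f32 := LinearMap.inr K A D ∘ₗ g.f21
  f33 := (g.f33.prod g.f23).coprod ((0 : D →ₗ[K] A).prod g.f22)

/-- Since `f31` is the inclusion and `f11`, `f21` vanish, the equations force `x33` to act on `A` as
`x11`, and `x13`, `x23` to vanish on `A`. The blocks `x22`, `x11` and those of `x23`, `x33` on `D`
then satisfy the equations of `g`. -/
theorem WedgeFunctional.Rigid.toChain {g : WedgeFunctional K B D A} (hg : g.Rigid) :
    g.toChain.Rigid := by
  rintro ⟨x11, x12, x13, x22, x23, x33⟩ ⟨h31, h21, h11, h22, h32, h33⟩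
  obtain ⟨p', q', rfl⟩ := exists_eq_coprod x33
  obtain ⟨p, r, rfl⟩ := exists_eq_prod p'
  obtain ⟨q, s, rfl⟩ := exists_eq_prod q'
  obtain ⟨u', u, rfl⟩ := exists_eq_coprod x23
  obtain ⟨w', w, rfl⟩ := exists_eq_coprod x13
  simp [WedgeFunctional.toChain, Prod.ext_iff] at h31 h21 h11 h22 h32 h33
  replace h21 (a : A) := (h21 a).symm
  replace h11 (a : A) := (h11 a).symm
  have h33l (a : A) := h33 a 0
  have h33r (d : D) := h33 0 d
  have hp (a : A) : p a = x11 a := ((h31 a).1).symm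
  have hr (a : A) : r a = 0 := (h31 a).2.symm
  simp [h21, h11, hr, hp] at h33l h33r
  obtain ⟨t, ht⟩ := hg ⟨x22, u, s, q, x11⟩
    { h21 := fun v => (h32 v).2
      h11 := fun v => h22 v
      h22 := fun v => by
        have := (h33r v).2
        dsimp only
        linear_combination (norm := module) this
      h23 := fun v => (h33l v).2
      h33 := fun v => (h33l v).1 }
  obtain ⟨t22, tu, ts, tq, t11⟩ := ht
  dsimp only at t22 tu ts tq t11
  refine ⟨t, ⟨t11, fun v => ?_, ?_, t22, ?_, ?_⟩⟩
  · simpa [tq] using (h32 v).1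
  · rintro ⟨a, d⟩
    simpa [h11, tq] using (h33r d).1
  · rintro ⟨a, d⟩
    simp [h21, tu]
  · rintro ⟨a, d⟩
    simp [hp, hr, tq, t11, ts]

/-- The reduction of a chain functional that embeds the first block into the last one. -/
theorem ChainFunctional.Rigid.exists_wedge {f : ChainFunctional K A B (A × D)} (hf : f.Rigid)
    (h : f.f31 = LinearMap.inl K A D) : ∃ g : WedgeFunctional K B D A, g.Rigid := by
  obtain ⟨f11, f21, f22, f31, f32, f33⟩ := f
  obtain ⟨m, l, rfl⟩ := exists_eq_prod f32
  obtain ⟨p', q', rfl⟩ := exists_eq_coprod f33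
  obtain ⟨g11, g21, rfl⟩ := exists_eq_prod p'
  obtain ⟨g12, g22, rfl⟩ := exists_eq_prod q'
  dsimp only at h
  subst h
  refine ⟨⟨f22 - f21 ∘ₗ m, l, g22, g21 + l ∘ₗ f21, g11 + f11 + m ∘ₗ f21⟩, ?_⟩
  rintro ⟨x22, u, s, q, p⟩ ⟨h21, h11, h22, h23, h33⟩
  simp at h21 h11 h22 h23 h33
  -- As `f31` is an inclusion, the equations `h32`, `h21`, `h11`, `h33` can be solved explicitly for
  -- `x12`, for `x23` and `x13` on `A`, and for `x13` on `D`; these are the solutions. On `D`, `x23`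
  -- is free, and the shift by `f21 ∘ₗ q` turns the remaining equations into those of the corrected
  -- wedge functional.
  let x12 : B →ₗ[K] A := p ∘ₗ m + q ∘ₗ l - m ∘ₗ x22
  let x23 : A × D →ₗ[K] B := (f21 ∘ₗ p - x22 ∘ₗ f21).coprod (u + f21 ∘ₗ q)
  let x13 : A × D →ₗ[K] A := (f11 ∘ₗ p - p ∘ₗ f11 - x12 ∘ₗ f21).coprod
    (p ∘ₗ g12 + q ∘ₗ g22 - m ∘ₗ u - m ∘ₗ f21 ∘ₗ q - g11 ∘ₗ q - g12 ∘ₗ s)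
  obtain ⟨t, ht⟩ := hf ⟨p, x12, x13, x22, x23, (p.prod 0).coprod (q.prod s)⟩
    { h31 := fun v => by simp
      h21 := fun v => by simp [x23]
      h11 := fun v => by simp [x13]
      h22 := fun v => by
        have := h11 v
        simp [x12, x23]
        linear_combination (norm := module) this
      h32 := fun v => by simp [x12, h21]
      h33 := by
        rintro ⟨a, d⟩
        have e33 := h33 a
        have e23 := h23 a
        have e22 := h22 d
        simp [x13, x23, x12, Prod.ext_iff]
        constructor
        · linear_combination (norm := module) e33
        · linear_combination (norm := module) e22 + e23 - h21 (f21 a) }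
  obtain ⟨t11, t12, t13, t22, t23, t33⟩ := ht
  dsimp only at t11 t12 t13 t22 t23 t33
  have tq (d : D) : q d = 0 := by simpa using congrArg Prod.fst (t33 (0, d))
  refine ⟨t, ⟨t22, fun d => ?_, fun d => ?_, tq, t11⟩⟩
  · simpa [x23, tq] using t23 (0, d)
  · simpa using congrArg Prod.snd (t33 (0, d))

/-- Adjoining to a chain functional a block that the functional embeds into the last two. -/
def ChainFunctional.toWedge (g : ChainFunctional K C A D) : WedgeFunctional K A (A × D) C where
  f11 := 0
  f21 := LinearMap.inl K A D
  f22 := (g.f22.prod g.f32).coprod ((0 : D →ₗ[K] A).prod g.f33)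
  f23 := g.f21.prod g.f31
  f33 := g.f11

/-- The inclusion `f21` forces `x22` to act on `A` as `x11`, and `f11 = 0` makes `x12` vanish on
`A`. What is left is a block upper triangular element for `C`, `A`, `D`, which stabilizes `g`. -/
theorem ChainFunctional.Rigid.toWedge {g : ChainFunctional K C A D} (hg : g.Rigid) :
    g.toWedge.Rigid := by
  rintro ⟨x11, x12, x22, x32, x33⟩ ⟨h21, h11, h22, h23, h33⟩
  obtain ⟨p', q', rfl⟩ := exists_eq_coprod x22
  obtain ⟨p, r, rfl⟩ := exists_eq_prod p'
  obtain ⟨q, s, rfl⟩ := exists_eq_prod q'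
  obtain ⟨y, z, rfl⟩ := exists_eq_coprod x32
  obtain ⟨w', w, rfl⟩ := exists_eq_coprod x12
  simp [ChainFunctional.toWedge, Prod.ext_iff] at h21 h11 h22 h23 h33
  replace h11 (a : A) := (h11 a).symm
  have h22l (a : A) := h22 a 0
  have h22r (d : D) := h22 0 d
  have hp (a : A) : p a = x11 a := ((h21 a).1).symm
  have hr (a : A) : r a = 0 := (h21 a).2.symm
  simp [hr, hp, h11] at h22l h22r h23
  obtain ⟨t, ht⟩ := hg ⟨x33, y, z, x11, q, s⟩
    { h31 := fun v => (h23 v).2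
      h21 := fun v => (h23 v).1
      h11 := fun v => by
        have := h33 v
        dsimp only
        linear_combination (norm := module) this
      h22 := fun v => by
        have := (h22l v).1
        dsimp only
        linear_combination (norm := module) this
      h32 := fun v => by
        have := (h22l v).2
        dsimp only
        linear_combination (norm := module) this
      h33 := fun v => by
        have := (h22r v).2
        dsimp only
        linear_combination (norm := module) this }
  obtain ⟨t33, ty, tz, t11, tq, ts⟩ := ht
  dsimp only at t33 ty tz t11 tq ts
  refine ⟨t, ⟨t11, ?_, ?_, ?_, t33⟩⟩
  · rintro ⟨a, d⟩
    simpa [h11, tq, tz, ts, t11] using (h22r d).1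
  · rintro ⟨a, d⟩
    simp [hp, hr, tq, t11, ts]
  · rintro ⟨a, d⟩
    simp [ty, tz]

/-- The reduction of a wedge functional that embeds the first block into the second one. -/
theorem WedgeFunctional.Rigid.exists_chain {f : WedgeFunctional K A (A × D) C} (hf : f.Rigid)
    (h : f.f21 = LinearMap.inl K A D) : ∃ g : ChainFunctional K C A D, g.Rigid := by
  obtain ⟨f11, f21, f22, f23, f33⟩ := f
  obtain ⟨m, l, rfl⟩ := exists_eq_prod f23
  obtain ⟨p', q', rfl⟩ := exists_eq_coprod f22
  obtain ⟨g11, g21, rfl⟩ := exists_eq_prod p'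
  obtain ⟨g12, g22, rfl⟩ := exists_eq_prod q'
  dsimp only at h
  subst h
  refine ⟨⟨f33, m, g11 + f11, l, g21, g22⟩, ?_⟩
  rintro ⟨x33, y, z, p, q, s⟩ ⟨h31, h21, h11, h22, h32, h33⟩
  simp at h31 h21 h11 h22 h32 h33
  -- The `A`-component of `h22`, solved for `x12`. Substituting it into `h11` is what merges `f11`
  -- with `g11` in the new functional.
  let x12 : A × D →ₗ[K] A := (p ∘ₗ g11 + q ∘ₗ g21 - g11 ∘ₗ p - m ∘ₗ y).coprod
    (p ∘ₗ g12 + q ∘ₗ g22 - g11 ∘ₗ q - g12 ∘ₗ s - m ∘ₗ z)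
  obtain ⟨t, ht⟩ := hf ⟨p, x12, (p.prod 0).coprod (q.prod s), y.coprod z, x33⟩
    { h21 := fun v => by simp
      h11 := fun v => by
        have := h22 v
        simp [x12]
        linear_combination (norm := module) this
      h22 := by
        rintro ⟨a, d⟩
        have e32 := h32 a
        have e33 := h33 d
        simp [x12, Prod.ext_iff]
        constructor
        · module
        · linear_combination (norm := module) e32 + e33
      h23 := fun v => by simp [h31, h21]
      h33 := fun v => by
        have := h11 v
        simp
        linear_combination (norm := module) this }
  obtain ⟨t11, t12, t22, t32, t33⟩ := ht
  dsimp only at t11 t12 t22 t32 t33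
  refine ⟨t, ⟨t33, fun a => ?_, fun d => ?_, t11, fun d => ?_, fun d => ?_⟩⟩
  · simpa using t32 (a, 0)
  · simpa using t32 (0, d)
  · simpa using congrArg Prod.fst (t22 (0, d))
  · simpa using congrArg Prod.snd (t22 (0, d))

/-- Enlarging the first block of a wedge functional by a copy of the second one. -/
def WedgeFunctional.enlarge (g : WedgeFunctional K A B C) : WedgeFunctional K (B × A) B C where
  f11 := (0 : B →ₗ[K] B × A).coprod (g.f21.prod g.f11)
  f21 := LinearMap.fst K B A
  f22 := g.f22
  f23 := g.f23
  f33 := g.f33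

/-- The projection `f21` forces `x11` to preserve `A` and to induce `x22` on the quotient `B`. The
component `B → A` of `x11` takes over the role of `x12` for `g`. -/
theorem WedgeFunctional.Rigid.enlarge {g : WedgeFunctional K A B C} (hg : g.Rigid) :
    g.enlarge.Rigid := by
  rintro ⟨x11, x12, x22, x32, x33⟩ ⟨h21, h11, h22, h23, h33⟩
  obtain ⟨p', q', rfl⟩ := exists_eq_coprod x11
  obtain ⟨p, r, rfl⟩ := exists_eq_prod p'
  obtain ⟨q, s, rfl⟩ := exists_eq_prod q'
  obtain ⟨w, w', rfl⟩ := exists_eq_prod x12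
  simp [WedgeFunctional.enlarge, Prod.ext_iff] at h21 h11 h22 h23 h33
  have hp (b : B) : p b = x22 b := by simpa using h21 b 0
  have hq (a : A) : q a = 0 := by simpa using h21 0 a
  have h11l (b : B) := h11 b 0
  have h11r (a : A) := h11 0 a
  simp [hq, hp] at h11l h11r
  obtain ⟨t, ht⟩ := hg ⟨s, r, x22, x32, x33⟩
    { h21 := fun v => (h11r v).1
      h11 := fun v => by
        have := (h11r v).2
        dsimp only
        linear_combination (norm := module) this
      h22 := fun v => by
        have e22 := h22 v
        have e11 := (h11l v).1
        dsimp only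
        linear_combination (norm := module) e22 + e11
      h23 := h23
      h33 := h33 }
  obtain ⟨ts, tr, t22, t32, t33⟩ := ht
  dsimp only at ts tr t22 t32 t33
  refine ⟨t, ⟨?_, fun b => ?_, t22, t32, t33⟩⟩
  · rintro ⟨b, a⟩
    simp [hp, hq, t22, tr, ts]
  · have := h11l b
    simp [tr] at this
    simp [Prod.ext_iff, ← this.1, ← this.2]

/-- The reduction of a wedge functional that projects the first block onto the second one. -/
theorem WedgeFunctional.Rigid.exists_wedge {f : WedgeFunctional K (B × A) B C} (hf : f.Rigid)
    (h : f.f21 = LinearMap.fst K B A) : ∃ g : WedgeFunctional K A B C, g.Rigid := by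
  obtain ⟨f11, f21, f22, f23, f33⟩ := f
  obtain ⟨p', q', rfl⟩ := exists_eq_coprod f11
  obtain ⟨g11, g21, rfl⟩ := exists_eq_prod p'
  obtain ⟨g12, g22, rfl⟩ := exists_eq_prod q'
  dsimp only at h
  subst h
  refine ⟨⟨g22, g12, f22 + g11, f23, f33⟩, ?_⟩
  rintro ⟨s, r, x22, x32, x33⟩ ⟨h21, h11, h22, h23, h33⟩
  simp at h21 h11 h22 h23 h33
  -- The equation `h11` on the summand `B`, where `f21` is the identity, solved for `x12`.
  let x12 : B →ₗ[K] B × A := (g11 ∘ₗ x22 + g12 ∘ₗ r - x22 ∘ₗ g11).prod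
    (g21 ∘ₗ x22 + g22 ∘ₗ r - r ∘ₗ g11 - s ∘ₗ g21)
  obtain ⟨t, ht⟩ := hf ⟨(x22.prod r).coprod ((0 : A →ₗ[K] B).prod s), x12, x22, x32, x33⟩
    { h21 := fun v => by simp
      h11 := by
        rintro ⟨b, a⟩
        have e11 := h11 a
        have e21 := h21 a
        simp [x12, Prod.ext_iff]
        constructor
        · linear_combination (norm := module) e21
        · linear_combination (norm := module) e11
      h22 := fun v => by
        have := h22 v
        simp [x12]
        linear_combination (norm := module) this
      h23 := h23
      h33 := h33 }
  obtain ⟨t11, t12, t22, t32, t33⟩ := ht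
  dsimp only at t11 t12 t22 t32 t33
  refine ⟨t, ⟨fun a => ?_, fun b => ?_, t22, t32, t33⟩⟩
  · simpa using congrArg Prod.snd (t11 (0, a))
  · simpa using congrArg Prod.snd (t11 (b, 0))

/-- The transpose of a chain functional. -/
def ChainFunctional.transpose (f : ChainFunctional K A B C) :
    ChainFunctional K (Dual K C) (Dual K B) (Dual K A) where
  f11 := f.f33.dualMap
  f21 := f.f32.dualMap
  f22 := f.f22.dualMap
  f31 := f.f31.dualMap
  f32 := f.f21.dualMap
  f33 := f.f11.dualMap

theorem exists_eq_dualMap [FiniteDimensional K A] [FiniteDimensional K B]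
    (y : Dual K B →ₗ[K] Dual K A) : ∃ x : A →ₗ[K] B, y = x.dualMap := by
  refine ⟨(evalEquiv K B).symm ∘ₗ y.dualMap ∘ₗ evalEquiv K A, ?_⟩
  ext φ a
  simp

theorem forall_dual_apply_eq_iff {v w : A} : (∀ φ : Dual K A, φ v = φ w) ↔ v = w := by
  rw [← sub_eq_zero, ← forall_dual_apply_eq_zero_iff K]
  simp [sub_eq_zero]

/-- Transposition reverses the order of the blocks and only changes the sign of the commutator, so
it carries stabilizers to stabilizers. -/
theorem ChainFunctional.Rigid.transpose [FiniteDimensional K A] [FiniteDimensional K B]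
    [FiniteDimensional K C] {f : ChainFunctional K A B C} (hf : f.Rigid) : f.transpose.Rigid := by
  rintro ⟨x11, x12, x13, x22, x23, x33⟩ ⟨h31, h21, h11, h22, h32, h33⟩
  obtain ⟨x11, rfl⟩ := exists_eq_dualMap x11
  obtain ⟨x12, rfl⟩ := exists_eq_dualMap x12
  obtain ⟨x13, rfl⟩ := exists_eq_dualMap x13
  obtain ⟨x22, rfl⟩ := exists_eq_dualMap x22
  obtain ⟨x23, rfl⟩ := exists_eq_dualMap x23
  obtain ⟨x33, rfl⟩ := exists_eq_dualMap x33
  simp only [ChainFunctional.transpose, LinearMap.ext_iff, LinearMap.dualMap_apply,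
    LinearMap.add_apply, ← map_add] at h31 h21 h11 h22 h32 h33
  simp only [forall_comm (α := Dual K _), forall_dual_apply_eq_iff] at h31 h21 h11 h22 h32 h33
  obtain ⟨t, ht⟩ := hf ⟨x33, x23, x13, x22, x12, x11⟩
    { h31 := fun v => (h31 v).symm
      h21 := fun v => (h32 v).symm.trans (add_comm _ _)
      h11 := fun v => by
        have := h33 v
        dsimp only
        linear_combination (norm := module) -this
      h22 := fun v => by
        have := h22 v
        dsimp only
        linear_combination (norm := module) -this
      h32 := fun v => by
        have := h21 v
        dsimp only
        linear_combination (norm := module) -this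
      h33 := fun v => by
        have := h11 v
        dsimp only
        linear_combination (norm := module) -this }
  exact ⟨t,
    { h11 := fun φ => LinearMap.ext fun v => by simpa using congrArg φ (ht.h33 v)
      h12 := fun φ => LinearMap.ext fun v => by simpa using congrArg φ (ht.h23 v)
      h13 := fun φ => LinearMap.ext fun v => by simpa using congrArg φ (ht.h13 v)
      h22 := fun φ => LinearMap.ext fun v => by simpa using congrArg φ (ht.h22 v)
      h23 := fun φ => LinearMap.ext fun v => by simpa using congrArg φ (ht.h12 v)
      h33 := fun φ => LinearMap.ext fun v => by simpa using congrArg φ (ht.h11 v) }⟩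

end Reduction

/-! ### Reduction in terms of block sizes, and the Euclidean algorithm -/

section Dimension

variable (K : Type*) [Field K]

/-- Some functional on the block upper triangular matrices with diagonal blocks of sizes
`a`, `b`, `c` has only scalars in its stabilizer. -/
def ChainFrobenius (a b c : ℕ) : Prop :=
  ∃ f : ChainFunctional K (Fin a → K) (Fin b → K) (Fin c → K), f.Rigid

/-- Some functional on the algebra of endomorphisms of `K ^ a × K ^ b × K ^ c` that preserve
the first and the last factor has only scalars in its stabilizer. -/
def WedgeFrobenius (a b c : ℕ) : Prop :=
  ∃ f : WedgeFunctional K (Fin a → K) (Fin b → K) (Fin c → K), f.Rigid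

variable {K}

section

variable {A B C : Type*} [AddCommGroup A] [Module K A] [AddCommGroup B] [Module K B]
  [AddCommGroup C] [Module K C]

/-- The block `x13` meets `f` only through `f31`, so a nonzero `x13` annihilated by `f31` on both
sides would be a non-scalar element of the stabilizer. -/
theorem ChainFunctional.Rigid.injective_or_surjective {f : ChainFunctional K A B C}
    (hf : f.Rigid) : Function.Injective f.f31 ∨ Function.Surjective f.f31 := by
  by_contra! h
  obtain ⟨y, hy₁, hy₂, v, hv⟩ := exists_two_sided_annihilator h.1 h.2
  obtain ⟨t, ht⟩ := hf ⟨0, 0, y, 0, 0, 0⟩ (by constructor <;> simp [hy₁, hy₂])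
  exact hv (ht.h13 v)

theorem WedgeFunctional.Rigid.injective_or_surjective {f : WedgeFunctional K A B C}
    (hf : f.Rigid) : Function.Injective f.f21 ∨ Function.Surjective f.f21 := by
  by_contra! h
  obtain ⟨y, hy₁, hy₂, v, hv⟩ := exists_two_sided_annihilator h.1 h.2
  obtain ⟨t, ht⟩ := hf ⟨0, y, 0, 0, 0⟩ (by constructor <;> simp [hy₁, hy₂])
  exact hv (ht.h12 v)

end

section

variable {A C : Type*} [AddCommGroup A] [Module K A] [AddCommGroup C] [Module K C]
  [FiniteDimensional K A] [FiniteDimensional K C]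

theorem injective_of_injective_or_surjective {f : A →ₗ[K] C} (h : finrank K A ≤ finrank K C)
    (hf : Function.Injective f ∨ Function.Surjective f) : Function.Injective f := by
  refine hf.elim id fun hs => ?_
  have := LinearMap.finrank_le_finrank_of_surjective hs
  exact (LinearMap.injective_iff_surjective_of_finrank_eq_finrank (le_antisymm h this)).2 hs

theorem surjective_of_injective_or_surjective {f : A →ₗ[K] C} (h : finrank K C ≤ finrank K A)
    (hf : Function.Injective f ∨ Function.Surjective f) : Function.Surjective f := by
  refine hf.elim (fun hs => ?_) id
  have := LinearMap.finrank_le_finrank_of_injective hs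
  exact (LinearMap.injective_iff_surjective_of_finrank_eq_finrank (le_antisymm this h)).1 hs

end

section

variable {A B C : Type*} [AddCommGroup A] [Module K A] [AddCommGroup B] [Module K B]
  [AddCommGroup C] [Module K C] [FiniteDimensional K A] [FiniteDimensional K B]
  [FiniteDimensional K C] {a b c : ℕ}

theorem ChainFunctional.Rigid.chainFrobenius {f : ChainFunctional K A B C} (hf : f.Rigid)
    (ha : finrank K A = a) (hb : finrank K B = b) (hc : finrank K C = c) :
    ChainFrobenius K a b c :=
  ⟨_, hf.congr (LinearEquiv.ofFinrankEq _ _ (by simpa)) (LinearEquiv.ofFinrankEq _ _ (by simpa))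
    (LinearEquiv.ofFinrankEq _ _ (by simpa))⟩

theorem WedgeFunctional.Rigid.wedgeFrobenius {f : WedgeFunctional K A B C} (hf : f.Rigid)
    (ha : finrank K A = a) (hb : finrank K B = b) (hc : finrank K C = c) :
    WedgeFrobenius K a b c :=
  ⟨_, hf.congr (LinearEquiv.ofFinrankEq _ _ (by simpa)) (LinearEquiv.ofFinrankEq _ _ (by simpa))
    (LinearEquiv.ofFinrankEq _ _ (by simpa))⟩

end

theorem chainFrobenius_add_iff (a b d : ℕ) :
    ChainFrobenius K a b (a + d) ↔ WedgeFrobenius K b d a := by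
  constructor
  · rintro ⟨f, hf⟩
    have hi := injective_of_injective_or_surjective (by simp) hf.injective_or_surjective
    obtain ⟨r, hr⟩ := f.f31.exists_leftInverse_of_injective (LinearMap.ker_eq_bot.2 hi)
    obtain ⟨e, he, -⟩ := exists_equiv_prod (B := Fin d → K) hr (by simp)
    exact (hf.congr (LinearEquiv.refl _ _) (LinearEquiv.refl _ _) e).exists_wedge he
  · rintro ⟨g, hg⟩
    exact hg.toChain.chainFrobenius (by simp) (by simp) (by simp)

theorem wedgeFrobenius_add_middle_iff (a d c : ℕ) :
    WedgeFrobenius K a (a + d) c ↔ ChainFrobenius K c a d := by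
  constructor
  · rintro ⟨f, hf⟩
    have hi := injective_of_injective_or_surjective (by simp) hf.injective_or_surjective
    obtain ⟨r, hr⟩ := f.f21.exists_leftInverse_of_injective (LinearMap.ker_eq_bot.2 hi)
    obtain ⟨e, he, -⟩ := exists_equiv_prod (B := Fin d → K) hr (by simp)
    exact (hf.congr (LinearEquiv.refl _ _) e (LinearEquiv.refl _ _)).exists_chain he
  · rintro ⟨g, hg⟩
    exact hg.toWedge.wedgeFrobenius (by simp) (by simp) (by simp)

theorem wedgeFrobenius_add_left_iff (a b c : ℕ) :
    WedgeFrobenius K (b + a) b c ↔ WedgeFrobenius K a b c := by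
  constructor
  · rintro ⟨f, hf⟩
    have hs := surjective_of_injective_or_surjective (by simp) hf.injective_or_surjective
    obtain ⟨i, hi⟩ := f.f21.exists_rightInverse_of_surjective (LinearMap.range_eq_top.2 hs)
    obtain ⟨e, -, he⟩ := exists_equiv_prod (B := Fin a → K) hi (by simp)
    refine (hf.congr e (LinearEquiv.refl _ _) (LinearEquiv.refl _ _)).exists_wedge ?_
    rw [← LinearMap.cancel_right e.surjective, he]
    ext; simp [WedgeFunctional.congr]
  · rintro ⟨g, hg⟩
    exact hg.enlarge.wedgeFrobenius (by simp) (by simp) (by simp)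

theorem ChainFrobenius.symm {a b c : ℕ} (h : ChainFrobenius K a b c) :
    ChainFrobenius K c b a := by
  obtain ⟨f, hf⟩ := h
  exact hf.transpose.chainFrobenius (by simp) (by simp) (by simp)

theorem chainFrobenius_comm (a b c : ℕ) : ChainFrobenius K a b c ↔ ChainFrobenius K c b a :=
  ⟨.symm, .symm⟩

theorem le_one_of_forall_scalar {c : ℕ}
    (h : ∀ x : (Fin c → K) →ₗ[K] (Fin c → K), ∃ t : K, ∀ v, x v = t • v) : c ≤ 1 := by
  by_contra! hc
  obtain ⟨t, ht⟩ := h ((LinearMap.proj ⟨0, by omega⟩ : (Fin c → K) →ₗ[K] K).smulRight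
    (Pi.single ⟨1, hc⟩ 1))
  have hne : (⟨1, hc⟩ : Fin c) ≠ ⟨0, by omega⟩ := by simp
  simpa [hne] using congrFun (ht (Pi.single ⟨0, by omega⟩ 1)) ⟨1, hc⟩

theorem exists_scalar_of_fin_one (x : (Fin 1 → K) →ₗ[K] (Fin 1 → K)) :
    ∃ t : K, ∀ v, x v = t • v := by
  refine ⟨x 1 0, fun v => ?_⟩
  have hv : v = v 0 • (1 : Fin 1 → K) := by
    ext i
    simp [Subsingleton.elim i 0]
  conv_lhs => rw [hv, map_smul]
  ext i
  simp [Subsingleton.elim i 0, mul_comm]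

theorem map_fin_zero_eq_zero {M : Type*} [AddCommGroup M] [Module K M]
    (f : (Fin 0 → K) →ₗ[K] M) (v : Fin 0 → K) : f v = 0 := by
  rw [Subsingleton.elim v 0, map_zero]

theorem wedgeFrobenius_zero_iff (a c : ℕ) (h : 0 < a + c) :
    WedgeFrobenius K a 0 c ↔ a + c = 1 := by
  constructor
  · rintro ⟨f, hf⟩
    -- The functional commutes with itself, so by rigidity it is scalar; then every pair of diagonal
    -- blocks stabilizes it.
    obtain ⟨t, ht⟩ := hf ⟨f.f11, 0, 0, 0, f.f33⟩
      (by constructor <;> intros <;> simp [eq_iff_true_of_subsingleton])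
    have h11 : ∀ v, f.f11 v = t • v := ht.h11
    have h33 : ∀ v, f.f33 v = t • v := ht.h33
    have all (x y) := hf ⟨x, 0, 0, 0, y⟩
      (by constructor <;> intros <;> simp [eq_iff_true_of_subsingleton, h11, h33])
    have ha : a ≤ 1 := le_one_of_forall_scalar fun x => (all x 0).imp fun _ h => h.h11
    have hc : c ≤ 1 := le_one_of_forall_scalar fun x => (all 0 x).imp fun _ h => h.h33
    by_contra hne
    obtain ⟨rfl, rfl⟩ : a = 1 ∧ c = 1 := by omega
    obtain ⟨s, hs⟩ := all 0 LinearMap.id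
    have h0 := congrFun (hs.h11 1) 0
    have h1 := congrFun (hs.h33 1) 0
    simp at h0 h1
    exact one_ne_zero (h1.trans h0.symm)
  · intro h1
    refine ⟨⟨0, 0, 0, 0, 0⟩, fun x _ => ?_⟩
    obtain ⟨rfl, rfl⟩ | ⟨rfl, rfl⟩ : a = 1 ∧ c = 0 ∨ a = 0 ∧ c = 1 := by omega
    · obtain ⟨t, ht⟩ := exists_scalar_of_fin_one x.x11
      exact ⟨t, ht, map_fin_zero_eq_zero _, fun v => Subsingleton.elim _ _,
        fun v => Subsingleton.elim _ _, fun v => Subsingleton.elim _ _⟩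
    · obtain ⟨t, ht⟩ := exists_scalar_of_fin_one x.x33
      exact ⟨t, fun v => Subsingleton.elim _ _, fun v => Subsingleton.elim _ _,
        fun v => Subsingleton.elim _ _, map_fin_zero_eq_zero _, ht⟩

theorem chainFrobenius_zero_zero_iff (c : ℕ) (h : 0 < c) :
    ChainFrobenius K 0 0 c ↔ c = 1 := by
  constructor
  · rintro ⟨f, hf⟩
    obtain ⟨t, ht⟩ := hf ⟨0, 0, 0, 0, 0, f.f33⟩
      (by constructor <;> intro v <;> simp [map_fin_zero_eq_zero])
    have h33 : ∀ v, f.f33 v = t • v := ht.h33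
    have all (x) := hf ⟨0, 0, 0, 0, 0, x⟩
      (by constructor <;> intro v <;> simp [map_fin_zero_eq_zero, h33])
    have hc : c ≤ 1 := le_one_of_forall_scalar fun x => (all x).imp fun _ h => h.h33
    omega
  · rintro rfl
    refine ⟨⟨0, 0, 0, 0, 0, 0⟩, fun x _ => ?_⟩
    obtain ⟨t, ht⟩ := exists_scalar_of_fin_one x.x33
    exact ⟨t, fun v => Subsingleton.elim _ _, fun v => Subsingleton.elim _ _,
      fun v => Subsingleton.elim _ _, fun v => Subsingleton.elim _ _,
      fun v => Subsingleton.elim _ _, ht⟩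

/-- Strong induction on the total size. Not every move lowers it, so the order within one size
matters: wedges with a > 0 either are base cases or drop strictly; chains with a ≤ c drop if a > 0,
and become wedges of the same size with positive first block if a = 0 < b; the other chains follow
by transposition; wedges with a = 0 become chains of the same size. -/
theorem frobenius_iff_gcd (N : ℕ) :
    (∀ a b c, a + b + c = N → 0 < N →
      (ChainFrobenius K a b c ↔ Nat.gcd (a + b) (b + c) = 1)) ∧
    (∀ a b c, a + b + c = N → 0 < N → (WedgeFrobenius K a b c ↔ Nat.gcd (a + c) b = 1)) := by
  induction N using Nat.strong_induction_on with
  | _ N ih =>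
  have wedge_of_pos : ∀ a b c, a + b + c = N → 0 < a →
      (WedgeFrobenius K a b c ↔ Nat.gcd (a + c) b = 1) := by
    intro a b c hN ha
    rcases Nat.eq_zero_or_pos b with rfl | hb
    · rw [wedgeFrobenius_zero_iff _ _ (by omega), Nat.gcd_zero_right]
    rcases le_total a b with hab | hab
    · obtain ⟨d, rfl⟩ := Nat.exists_eq_add_of_le hab
      rw [wedgeFrobenius_add_middle_iff,
        (ih (c + a + d) (by omega)).1 c a d rfl (by omega), add_comm c a]
    · obtain ⟨d, rfl⟩ := Nat.exists_eq_add_of_le hab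
      rw [wedgeFrobenius_add_left_iff, (ih (d + b + c) (by omega)).2 d b c rfl (by omega)]
      simp [add_assoc]
  have gcd_chain (a b d : ℕ) : Nat.gcd (a + b) (b + (a + d)) = Nat.gcd (b + a) d := by
    rw [← add_assoc, add_comm a b, Nat.gcd_self_add_right]
  have chain_of_le : ∀ a b c, a + b + c = N → 0 < N → a ≤ c → 0 < a ∨ 0 < b →
      (ChainFrobenius K a b c ↔ Nat.gcd (a + b) (b + c) = 1) := by
    intro a b c hN hpos hac h
    obtain ⟨d, rfl⟩ := Nat.exists_eq_add_of_le hac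
    rw [chainFrobenius_add_iff, gcd_chain]
    rcases Nat.eq_zero_or_pos a with rfl | ha
    · exact wedge_of_pos b d 0 (by omega) (by omega)
    · exact (ih (b + d + a) (by omega)).2 b d a rfl (by omega)
  have chain_le : ∀ a b c, a + b + c = N → 0 < N → a ≤ c →
      (ChainFrobenius K a b c ↔ Nat.gcd (a + b) (b + c) = 1) := by
    intro a b c hN hpos hac
    by_cases h : 0 < a ∨ 0 < b
    · exact chain_of_le a b c hN hpos hac h
    · obtain ⟨rfl, rfl⟩ : a = 0 ∧ b = 0 := by omega
      rw [chainFrobenius_zero_zero_iff c (by omega)]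
      simp
  have chain : ∀ a b c, a + b + c = N → 0 < N →
      (ChainFrobenius K a b c ↔ Nat.gcd (a + b) (b + c) = 1) := by
    intro a b c hN hpos
    rcases le_total a c with h | h
    · exact chain_le a b c hN hpos h
    · rw [chainFrobenius_comm, chain_le c b a (by omega) hpos h, Nat.gcd_comm, add_comm b a,
        add_comm c b]
  refine ⟨chain, fun a b c hN hpos => ?_⟩
  rcases Nat.eq_zero_or_pos a with rfl | ha
  · have := wedgeFrobenius_add_middle_iff (K := K) 0 b c
    rw [zero_add] at this
    rw [this, chain c 0 b (by omega) hpos]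
    simp
  · exact wedge_of_pos a b c hN ha

end Dimension

/-! ### From blocks to endomorphisms of a flagged space -/

section Endomorphism

variable {K : Type*} [Field K]
variable {A B C : Type*} [AddCommGroup A] [Module K A] [AddCommGroup B] [Module K B]
  [AddCommGroup C] [Module K C]

/-- The only endomorphisms `x` that preserve the flag `A ⊆ A × B ⊆ A × B × C`, and for which the
commutator of `f` and `x` lowers that flag by one step, are the scalars. -/
def FlagRigid (f : A × B × C →ₗ[K] A × B × C) : Prop :=
  ∀ x : A × B × C →ₗ[K] A × B × C,
    (∀ u, u.2 = 0 → (x u).2 = 0) → (∀ u, u.2.2 = 0 → (x u).2.2 = 0) →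
    (∀ u, u.2 = 0 → f (x u) - x (f u) = 0) →
    (∀ u, u.2.2 = 0 → (f (x u) - x (f u)).2 = 0) →
    (∀ u, (f (x u) - x (f u)).2.2 = 0) → ∃ t : K, ∀ u, x u = t • u

theorem exists_blocks (f : A × B × C →ₗ[K] A × B × C) :
    ∃ f11 f12 f13 f21 f22 f23 f31 f32 f33, f =
      LinearMap.coprod (LinearMap.prod f11 (LinearMap.prod f21 f31))
        (LinearMap.coprod (LinearMap.prod f12 (LinearMap.prod f22 f32))
          (LinearMap.prod f13 (LinearMap.prod f23 f33))) := by
  obtain ⟨f1, f', rfl⟩ := exists_eq_coprod f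
  obtain ⟨f2, f3, rfl⟩ := exists_eq_coprod f'
  obtain ⟨f11, f1', rfl⟩ := exists_eq_prod f1
  obtain ⟨f21, f31, rfl⟩ := exists_eq_prod f1'
  obtain ⟨f12, f2', rfl⟩ := exists_eq_prod f2
  obtain ⟨f22, f32, rfl⟩ := exists_eq_prod f2'
  obtain ⟨f13, f3', rfl⟩ := exists_eq_prod f3
  obtain ⟨f23, f33, rfl⟩ := exists_eq_prod f3'
  exact ⟨f11, f12, f13, f21, f22, f23, f31, f32, f33, rfl⟩

theorem ChainFunctional.Rigid.exists_flagRigid {g : ChainFunctional K A B C} (hg : g.Rigid) :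
    ∃ f : A × B × C →ₗ[K] A × B × C, FlagRigid f := by
  refine ⟨LinearMap.coprod (LinearMap.prod g.f11 (LinearMap.prod g.f21 g.f31))
    (LinearMap.coprod (LinearMap.prod 0 (LinearMap.prod g.f22 g.f32))
      (LinearMap.prod 0 (LinearMap.prod 0 g.f33))), ?_⟩
  intro x h1 h2 h3 h4 h5
  obtain ⟨x11, x12, x13, x21, x22, x23, x31, x32, x33, rfl⟩ := exists_blocks x
  have e1 (v : A) := h1 (v, 0) rfl
  have e2 (v : B) := h2 (0, v, 0) rfl
  have e3 (v : A) := h3 (v, 0) rfl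
  have e4 (v : B) := h4 (0, v, 0) rfl
  have e5 (v : C) := h5 (0, 0, v)
  simp at e1 e2
  simp [e1, e2, sub_eq_zero, Prod.ext_iff] at e3 e4 e5
  obtain ⟨t, ht⟩ := hg ⟨x11, x12, x13, x22, x23, x33⟩
    { h31 := fun v => (e3 v).2.2
      h21 := fun v => by
        have := (e3 v).2.1
        dsimp only
        linear_combination (norm := module) this
      h11 := fun v => by
        have := (e3 v).1
        dsimp only
        linear_combination (norm := module) this
      h22 := fun v => by
        have := (e4 v).1
        dsimp only
        linear_combination (norm := module) this
      h32 := fun v => by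
        have := (e4 v).2
        dsimp only
        linear_combination (norm := module) this
      h33 := fun v => by
        have := e5 v
        dsimp only
        linear_combination (norm := module) this }
  obtain ⟨t11, t12, t13, t22, t23, t33⟩ := ht
  dsimp only at t11 t12 t13 t22 t23 t33
  refine ⟨t, ?_⟩
  rintro ⟨u, v, w⟩
  simp [e1, e2, t11, t12, t13, t22, t23, t33]

/-- The blocks of `f` above the diagonal contribute only strictly block upper triangular terms to
the commutator, so they can be dropped. -/
theorem FlagRigid.exists_chain {f : A × B × C →ₗ[K] A × B × C} (hf : FlagRigid f) :
    ∃ g : ChainFunctional K A B C, g.Rigid := by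
  obtain ⟨f11, f12, f13, f21, f22, f23, f31, f32, f33, rfl⟩ := exists_blocks f
  refine ⟨⟨f11, f21, f22, f31, f32, f33⟩, ?_⟩
  rintro ⟨x11, x12, x13, x22, x23, x33⟩ ⟨h31, h21, h11, h22, h32, h33⟩
  dsimp only at h31 h21 h11 h22 h32 h33
  obtain ⟨t, ht⟩ := hf (LinearMap.coprod (LinearMap.prod x11 (LinearMap.prod 0 0))
      (LinearMap.coprod (LinearMap.prod x12 (LinearMap.prod x22 0))
        (LinearMap.prod x13 (LinearMap.prod x23 x33))))
    (by rintro ⟨u, v⟩ (rfl : v = 0); simp)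
    (by rintro ⟨u, v, w⟩ (rfl : w = 0); simp)
    (by
      rintro ⟨u, v⟩ (rfl : v = 0)
      have e21 := h21 u
      have e11 := h11 u
      simp [sub_eq_zero, h31]
      constructor
      · linear_combination (norm := module) e11
      · linear_combination (norm := module) e21)
    (by
      rintro ⟨u, v, w⟩ (rfl : w = 0)
      have e21 := h21 u
      have e31 := h31 u
      have e22 := h22 v
      have e32 := h32 v
      simp [sub_eq_zero]
      constructor
      · linear_combination (norm := module) e21 + e22
      · linear_combination (norm := module) e31 + e32)
    (by
      rintro ⟨u, v, w⟩
      have e31 := h31 u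
      have e32 := h32 v
      have e33 := h33 w
      simp [sub_eq_zero]
      linear_combination (norm := module) e31 + e32 + e33)
  have tA (v : A) := ht (v, 0, 0)
  have tB (v : B) := ht (0, v, 0)
  have tC (v : C) := ht (0, 0, v)
  simp at tA tB tC
  exact ⟨t, tA, fun v => (tB v).1, fun v => (tC v).1, fun v => (tB v).2, fun v => (tC v).2.1,
    fun v => (tC v).2.2⟩

end Endomorphism

/-! ### From endomorphisms to matrices -/

section Matrix

variable {K : Type*} [Field K]

/-- The entries of `M` in the rows from `r` on and the columns before `s` vanish. -/
def ZeroCorner {n : ℕ} (r s : ℕ) (M : Matrix (Fin n) (Fin n) K) : Prop :=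
  ∀ i j : Fin n, r ≤ i → (j : ℕ) < s → M i j = 0

theorem zeroCorner_iff {n r s : ℕ} {M : Matrix (Fin n) (Fin n) K} :
    ZeroCorner r s M ↔ ∀ v : Fin n → K, (∀ k : Fin n, s ≤ k → v k = 0) →
      ∀ k : Fin n, r ≤ k → M.mulVec v k = 0 := by
  constructor
  · intro h v hv k hk
    rw [Matrix.mulVec, dotProduct]
    refine Finset.sum_eq_zero fun j _ => ?_
    rcases lt_or_ge (j : ℕ) s with hj | hj
    · rw [h k j hk hj, zero_mul]
    · rw [hv j hj, mul_zero]
  · intro h i j hi hj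
    have := h (Pi.single j 1) (fun k hk => Pi.single_eq_of_ne (by rintro rfl; omega) 1) i hi
    simpa using this

/-- The only block upper triangular matrices `x`, with diagonal blocks of sizes `a`, `b`, `c`, for
which the commutator of `f` and `x` is strictly block upper triangular, are the scalars. -/
def MatrixRigid {n : ℕ} (a b : ℕ) (f : Matrix (Fin n) (Fin n) K) : Prop :=
  ∀ x : Matrix (Fin n) (Fin n) K, ZeroCorner a a x → ZeroCorner (a + b) (a + b) x →
    ZeroCorner 0 a (f * x - x * f) → ZeroCorner a (a + b) (f * x - x * f) →
    ZeroCorner (a + b) n (f * x - x * f) → ∃ t : K, x = t • 1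

variable (K) in
/-- The decomposition of `K ^ (a + b + c)` into three blocks of coordinates. -/
def blockEquiv (a b c : ℕ) :
    (Fin (a + b + c) → K) ≃ₗ[K] (Fin a → K) × (Fin b → K) × (Fin c → K) where
  toFun v := (fun k => v (Fin.castAdd c (Fin.castAdd b k)),
    fun k => v (Fin.castAdd c (Fin.natAdd a k)), fun k => v (Fin.natAdd (a + b) k))
  invFun w := Fin.append (Fin.append w.1 w.2.1) w.2.2
  map_add' _ _ := rfl
  map_smul' _ _ := rfl
  left_inv v := by
    ext k
    refine Fin.addCases (fun k => ?_) (fun k => ?_) k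
    · refine Fin.addCases (fun k => ?_) (fun k => ?_) k <;> simp
    · simp
  right_inv w := by ext <;> simp

theorem blockEquiv_snd_snd_eq_zero_iff {a b c : ℕ} {v : Fin (a + b + c) → K} :
    (blockEquiv K a b c v).2.2 = 0 ↔ ∀ k : Fin (a + b + c), a + b ≤ k → v k = 0 := by
  constructor
  · intro h k
    refine Fin.addCases (fun k hk => ?_) (fun k _ => congrFun h k) k
    simp at hk
    omega
  · intro h
    ext k
    exact h _ (by simp)

theorem blockEquiv_snd_eq_zero_iff {a b c : ℕ} {v : Fin (a + b + c) → K} :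
    (blockEquiv K a b c v).2 = 0 ↔ ∀ k : Fin (a + b + c), a ≤ k → v k = 0 := by
  constructor
  · intro h k hk
    rcases lt_or_ge (k : ℕ) (a + b) with hk' | hk'
    · obtain ⟨k, rfl⟩ : ∃ l : Fin b, k = Fin.castAdd c (Fin.natAdd a l) :=
        ⟨⟨k - a, by omega⟩, by ext; simp; omega⟩
      exact congrFun (congrArg Prod.fst h) k
    · exact blockEquiv_snd_snd_eq_zero_iff.1 (congrArg Prod.snd h) k hk'
  · intro h
    refine Prod.ext ?_ (blockEquiv_snd_snd_eq_zero_iff.2 fun k hk => h k (by omega))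
    ext k
    exact h _ (by simp)

theorem matrixRigid_iff_flagRigid {a b c : ℕ}
    (f : Matrix (Fin (a + b + c)) (Fin (a + b + c)) K) :
    MatrixRigid a b f ↔ FlagRigid ((blockEquiv K a b c).conj (Matrix.toLin' f)) := by
  have key (x : Matrix (Fin (a + b + c)) (Fin (a + b + c)) K) (v) :
      (f * x - x * f).mulVec v = f.mulVec (x.mulVec v) - x.mulVec (f.mulVec v) := by
    simp [Matrix.sub_mulVec]
  -- With all `a + b + c` columns in the corner, the support condition on `v` in `zeroCorner_iff`
  -- must become vacuous the other way round: it asks for zeros only at indices beyond the last.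
  have hn {M : Matrix (Fin (a + b + c)) (Fin (a + b + c)) K} : ZeroCorner (a + b) (a + b + c) M ↔
      ∀ v, (blockEquiv K a b c (M.mulVec v)).2.2 = 0 := by
    simp only [zeroCorner_iff, blockEquiv_snd_snd_eq_zero_iff]
    exact ⟨fun h v => h v fun k hk => absurd k.2 (by omega), fun h v _ => h v⟩
  have h0 {M : Matrix (Fin (a + b + c)) (Fin (a + b + c)) K} : ZeroCorner 0 a M ↔
      ∀ v, (blockEquiv K a b c v).2 = 0 → blockEquiv K a b c (M.mulVec v) = 0 := by
    simp [zeroCorner_iff, blockEquiv_snd_eq_zero_iff, funext_iff]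
  simp only [MatrixRigid, hn, h0]
  simp only [zeroCorner_iff, ← blockEquiv_snd_snd_eq_zero_iff, ← blockEquiv_snd_eq_zero_iff, key,
    FlagRigid]
  set e := blockEquiv K a b c
  refine (Matrix.toLin'.trans e.conj).toEquiv.forall_congr fun x => ?_
  have hs : (∃ t : K, x = t • 1) ↔ ∃ t : K, ∀ v, e (x.mulVec v) = t • e v := by
    refine exists_congr fun t => ?_
    rw [← Matrix.toLin'.injective.eq_iff, LinearMap.ext_iff]
    simp [← map_smul, Matrix.smul_mulVec]
  rw [hs]
  simp only [e.symm.surjective.forall]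
  simp [LinearEquiv.conj_apply]

end Matrix

theorem chainFrobenius_iff_matrixRigid {K : Type*} [Field K] {a b c : ℕ} :
    ChainFrobenius K a b c ↔
      ∃ f : Matrix (Fin (a + b + c)) (Fin (a + b + c)) K, MatrixRigid a b f := by
  constructor
  · rintro ⟨g, hg⟩
    obtain ⟨f, hf⟩ := hg.exists_flagRigid
    obtain ⟨f, rfl⟩ := (blockEquiv K a b c).conj.surjective f
    obtain ⟨f, rfl⟩ := Matrix.toLin'.surjective f
    exact ⟨f, (matrixRigid_iff_flagRigid f).2 hf⟩
  · rintro ⟨f, hf⟩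
    exact ((matrixRigid_iff_flagRigid f).1 hf).exists_chain

/-! ### The seaweed algebra in coordinates, and the trace form -/

section Membership

attribute [local instance 100] LieRing.ofAssociativeRing

variable {K : Type*} [Field K] {n : ℕ}

theorem mem_span_single_iff {S : Set (Fin n)} {v : Fin n → K} :
    v ∈ Submodule.span K ((fun k : Fin n => Pi.single k (1 : K)) '' S) ↔
      ∀ k, k ∉ S → v k = 0 := by
  constructor
  · intro hv k hk
    induction hv using Submodule.span_induction with
    | mem x hx =>
      obtain ⟨j, hj, rfl⟩ := hx
      exact Pi.single_eq_of_ne (by rintro rfl; exact hk hj) 1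
    | zero => rfl
    | add x y _ _ hx hy => rw [Pi.add_apply, hx, hy, add_zero]
    | smul r x _ hx => rw [Pi.smul_apply, hx, smul_zero]
  · intro h
    have hv : v = ∑ k, v k • Pi.single k (1 : K) := by
      ext k
      simp [Finset.sum_apply, Pi.single_apply]
    rw [hv]
    refine Submodule.sum_mem _ fun k _ => ?_
    by_cases hk : k ∈ S
    · exact Submodule.smul_mem _ _ (Submodule.subset_span ⟨k, hk, rfl⟩)
    · rw [h k hk, zero_smul]
      exact Submodule.zero_mem _

theorem mem_stabilizer_upperFlag_iff {x : List ℕ} {i : ℕ} {M : Matrix (Fin n) (Fin n) K} :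
    M ∈ stabilizer (upperFlag K n x i) ↔ ZeroCorner (x.take i).sum (x.take i).sum M := by
  rw [zeroCorner_iff]
  have (v : Fin n → K) : v ∈ upperFlag K n x i ↔ ∀ k : Fin n, (x.take i).sum ≤ k → v k = 0 := by
    simp [upperFlag, mem_span_single_iff]
  simp only [← this]
  rfl

theorem mem_stabilizer_lowerFlag_singleton {j : ℕ} {M : Matrix (Fin n) (Fin n) K} :
    M ∈ stabilizer (lowerFlag K n [n] j) := by
  intro v hv
  simp only [lowerFlag, mem_span_single_iff, Set.mem_ofPred_eq, not_le] at hv ⊢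
  rcases j with _ | j
  · simp
  · intro k _
    have : v = 0 := by
      ext k
      exact hv k (by simp)
    simp [this]

theorem mem_iInf_lieSubalgebra {L ι : Type*} [LieRing L] [LieAlgebra K L]
    {S : ι → LieSubalgebra K L} {x : L} : x ∈ ⨅ i, S i ↔ ∀ i, x ∈ S i := by
  rw [iInf, ← SetLike.mem_coe, LieSubalgebra.coe_sInf]
  simp

theorem mem_seaweed_iff {a b c : ℕ} (h : a + b + c = n) {M : Matrix (Fin n) (Fin n) K} :
    M ∈ seaweed K n [a, b, c] [n] ↔
      M.trace = 0 ∧ ZeroCorner a a M ∧ ZeroCorner (a + b) (a + b) M := by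
  rw [seaweed, LieSubalgebra.mem_inf, LieSubalgebra.mem_inf, mem_iInf_lieSubalgebra,
    mem_iInf_lieSubalgebra]
  simp only [mem_stabilizer_upperFlag_iff, mem_stabilizer_lowerFlag_singleton, implies_true,
    and_true]
  refine and_congr Iff.rfl ⟨fun H => ⟨by simpa using H 1, by simpa using H 2⟩, ?_⟩
  rintro ⟨h1, h2⟩ i
  match i with
  | 0 => intro i j _ hj; simp at hj
  | 1 => simpa using h1
  | 2 => simpa using h2
  | i + 3 =>
    intro i j hi _
    simp at hi
    omega

theorem trace_commutator_mul (f x y : Matrix (Fin n) (Fin n) K) :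
    (f * (x * y - y * x)).trace = ((f * x - x * f) * y).trace := by
  rw [mul_sub, sub_mul, Matrix.trace_sub, Matrix.trace_sub, ← mul_assoc, ← mul_assoc,
    Matrix.trace_mul_comm (f * y) x, ← mul_assoc]

/-- Strictly block upper triangular matrices are orthogonal to block upper triangular ones. -/
theorem trace_mul_eq_zero {a b : ℕ} {z y : Matrix (Fin n) (Fin n) K} (h1 : ZeroCorner 0 a z)
    (h2 : ZeroCorner a (a + b) z) (h3 : ZeroCorner (a + b) n z) (hy : ZeroCorner a a y)
    (hy' : ZeroCorner (a + b) (a + b) y) : (z * y).trace = 0 := by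
  refine Finset.sum_eq_zero fun j _ => ?_
  rw [Matrix.diag_apply, Matrix.mul_apply]
  refine Finset.sum_eq_zero fun i _ => ?_
  by_cases c1 : (i : ℕ) < a
  · rw [h1 j i (Nat.zero_le _) c1, zero_mul]
  by_cases c2 : a + b ≤ (j : ℕ)
  · rw [h3 j i c2 i.2, zero_mul]
  by_cases c3 : (j : ℕ) < a
  · rw [hy i j (by omega) c3, mul_zero]
  by_cases c4 : (i : ℕ) < a + b
  · rw [h2 j i (by omega) c4, zero_mul]
  · rw [hy' i j (by omega) (by omega), mul_zero]

theorem exists_eq_trace_mul (F : Matrix (Fin n) (Fin n) K →ₗ[K] K) :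
    ∃ f : Matrix (Fin n) (Fin n) K, ∀ x, F x = (f * x).trace := by
  refine ⟨Matrix.of fun i j => F (Matrix.single j i 1), fun x => ?_⟩
  conv_lhs => rw [Matrix.matrix_eq_sum_single x]
  have (i j : Fin n) : Matrix.single i j (x i j) = x i j • Matrix.single i j 1 := by simp
  simp only [this, map_sum, map_smul, smul_eq_mul, Matrix.trace, Matrix.diag_apply,
    Matrix.mul_apply, Matrix.of_apply]
  rw [Finset.sum_comm]
  simp [mul_comm]

theorem zeroCorner_sub_smul_one {r : ℕ} {M : Matrix (Fin n) (Fin n) K} (h : ZeroCorner r r M)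
    (t : K) : ZeroCorner r r (M - t • 1) := by
  intro i j hi hj
  have hne : i ≠ j := by rintro rfl; omega
  simp [h i j hi hj, Matrix.one_apply_ne hne]

theorem isFrobenius_iff_exists_ker_eq_bot {L : Type*} [LieRing L] [LieAlgebra K L]
    [Module.Finite K L] :
    IsFrobenius K L ↔ ∃ F : Dual K L, LinearMap.ker (kirillovForm K L F) = ⊥ := by
  simp only [← Submodule.finrank_eq_zero (R := K)]
  constructor
  · intro h
    obtain ⟨F, hF⟩ := Nat.sInf_mem
      (Set.range_nonempty fun F : Dual K L => finrank K (LinearMap.ker (kirillovForm K L F)))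
    exact ⟨F, hF.trans h⟩
  · rintro ⟨F, hF⟩
    exact Nat.le_zero.1 (hF ▸ ciInf_le (OrderBot.bddBelow _) F)

variable [CharZero K]

theorem sub_smul_one_mem_seaweed (hn : 0 < n) {a b c : ℕ} (h : a + b + c = n)
    {M : Matrix (Fin n) (Fin n) K} (h1 : ZeroCorner a a M) (h2 : ZeroCorner (a + b) (a + b) M) :
    M - (M.trace / n) • 1 ∈ seaweed K n [a, b, c] [n] := by
  refine (mem_seaweed_iff h).2
    ⟨?_, zeroCorner_sub_smul_one h1 _, zeroCorner_sub_smul_one h2 _⟩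
  have : (n : K) ≠ 0 := Nat.cast_ne_zero.2 hn.ne'
  simp [Matrix.trace_sub, this]

/-- Extend the functional to all matrices and write it as x ↦ tr(fx). Then `x` lies in the kernel
iff [f,x] is orthogonal to all block upper triangular matrices, that is, strictly block upper
triangular. Subtracting tr(x)/n passes between these matrices and the trace-zero ones. -/
theorem isFrobenius_seaweed_iff (hn : 0 < n) {a b c : ℕ} (h : a + b + c = n) :
    IsFrobenius K (seaweed K n [a, b, c] [n]) ↔
      ∃ f : Matrix (Fin n) (Fin n) K, MatrixRigid a b f := by
  have hn0 : (n : K) ≠ 0 := Nat.cast_ne_zero.2 hn.ne'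
  rw [isFrobenius_iff_exists_ker_eq_bot]
  constructor
  · rintro ⟨F, hF⟩
    obtain ⟨F', hF'⟩ := LinearMap.exists_extend (p := (seaweed K n [a, b, c] [n]).toSubmodule) F
    obtain ⟨f, hf⟩ := exists_eq_trace_mul F'
    have hFf (x : seaweed K n [a, b, c] [n]) : F x = (f * x.1).trace := by
      rw [← hf]
      exact (LinearMap.congr_fun hF' x).symm
    refine ⟨f, fun x h1 h2 h3 h4 h5 => ⟨x.trace / n, ?_⟩⟩
    have hx := sub_smul_one_mem_seaweed hn h h1 h2
    have hk : (⟨_, hx⟩ : seaweed K n [a, b, c] [n]) ∈ LinearMap.ker (kirillovForm K _ F) := by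
      rw [LinearMap.mem_ker]
      ext y
      obtain ⟨-, hy1, hy2⟩ := (mem_seaweed_iff h).1 y.2
      change F ⁅_, y⁆ = 0
      rw [hFf, LieSubalgebra.coe_bracket, Ring.lie_def, trace_commutator_mul]
      have : f * (x - (x.trace / n) • 1) - (x - (x.trace / n) • 1) * f = f * x - x * f := by
        simp [mul_sub, sub_mul]
      simp only [this]
      exact trace_mul_eq_zero h3 h4 h5 hy1 hy2
    rw [hF, Submodule.mem_bot] at hk
    exact sub_eq_zero.1 (congrArg Subtype.val hk)
  · rintro ⟨f, hf⟩
    refine ⟨(Matrix.traceLinearMap (Fin n) K K ∘ₗ LinearMap.mulLeft K f) ∘ₗ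
      (seaweed K n [a, b, c] [n]).toSubmodule.subtype, ?_⟩
    rw [eq_bot_iff]
    rintro ⟨x, hxm⟩ hx
    obtain ⟨hx0, hx1, hx2⟩ := (mem_seaweed_iff h).1 hxm
    have key (y : Matrix (Fin n) (Fin n) K) (hy1 : ZeroCorner a a y)
        (hy2 : ZeroCorner (a + b) (a + b) y) : ((f * x - x * f) * y).trace = 0 := by
      -- Testing on the trace-zero part of `y` suffices, because [f,x] has trace zero.
      have hy := sub_smul_one_mem_seaweed hn h hy1 hy2
      have := LinearMap.congr_fun (LinearMap.mem_ker.1 hx) ⟨_, hy⟩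
      change (f * (x * (y - (y.trace / n) • 1) - (y - (y.trace / n) • 1) * x)).trace = 0 at this
      rw [trace_commutator_mul, mul_sub, Matrix.trace_sub] at this
      simpa [Matrix.trace_sub, Matrix.trace_mul_comm x f] using this
    have entry (i j : Fin n) (hij : ¬ (a ≤ (i : ℕ) ∧ (j : ℕ) < a))
        (hij' : ¬ (a + b ≤ (i : ℕ) ∧ (j : ℕ) < a + b)) : (f * x - x * f) j i = 0 := by
      -- Pairing with a matrix unit that is block upper triangular reads off one entry of the
      -- commutator.
      have := key (Matrix.single i j 1)
        (fun k l hk hl => Matrix.single_apply_of_ne _ _ _ _ _ (by rintro ⟨rfl, rfl⟩; omega))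
        (fun k l hk hl => Matrix.single_apply_of_ne _ _ _ _ _ (by rintro ⟨rfl, rfl⟩; omega))
      simpa [Matrix.trace_mul_single] using this
    obtain ⟨t, rfl⟩ := hf x hx1 hx2
      (fun i j _ hj => entry j i (by omega) (by omega))
      (fun i j hi hj => entry j i (by omega) (by omega))
      (fun i j hi _ => entry j i (by omega) (by omega))
    have ht : t = 0 := by simpa [hn0] using hx0
    rw [Submodule.mem_bot]
    exact Subtype.ext (by simp [ht])

end Membership

end Seaweed

theorem mainTheorem1 (K : Type*) [Field K] [CharZero K] (n a b c : ℕ) (hn : 0 < n)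
    (habc : a + b + c = n) :
    Seaweed.IsFrobenius K (Seaweed.seaweed K n [a, b, c] [n]) ↔
      Nat.gcd (a + b) (b + c) = 1 := by
  rw [Seaweed.isFrobenius_seaweed_iff hn habc]
  subst habc
  rw [← Seaweed.chainFrobenius_iff_matrixRigid]
  exact (Seaweed.frobenius_iff_gcd _).1 a b c rfl hn
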